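/- Let $\mathcal H$ be a finite dimensional complex Hilbert space, let $M_0\subseteq B(\mathcal H)$ be a unital $*$-subalgebra, and let $\rho_0,\rho_1\in B(\mathcal H)$ be invertible density operators (positive, trace one). Let $E:B(\mathcal H)\to M_0$ be the trace preserving conditional expectation, i.e. the linear map determined by $\operatorname{Tr} X_0E(Y)=\operatorname{Tr} X_0Y$ for all $X_0\in M_0$, $Y\in B(\mathcal H)$. The subalgebra $M_0$ is called sufficient for $\{\rho_0,\rho_1\}$ if there is a completely positive trace preserving map $T:M_0\to B(\mathcal H)$ with $T(E(\rho_0))=\rho_0$ and $T(E(\rho_1))=\rho_1$. For an invertible density operator $\rho$ put $\langle X,Y\rangle_\rho=\operatorname{Tr}X^*\rho^{1/2}Y\rho^{1/2}$ and $\langle X,Y\rangle_{E(\rho)}=\operatorname{Tr}X^*E(\rho)^{1/2}YE(\rho)^{1/2}$. The generalized conditional expectation $E_\rho:B(\mathcal H)\to M_0$ is the map determined by $\langle X_0,Y\rangle_\rho=\langle X_0,E_\rho(Y)\rangle_{E(\rho)}$ for all $X_0\in M_0$, $Y\in B(\mathcal H)$; explicitly, $$E_\rho(X)=E(\rho)^{-1/2}\,E(\rho^{1/2}X\rho^{1/2})\,E(\rho)^{-1/2}.$$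 Let $F_\rho=\{X\in B(\mathcal H): E_\rho(X)=X\}$ be its set of fixed points, and let $$d_{\rho_0,\rho_1}=\rho_0^{-1/2}\rho_1\rho_0^{-1/2}$$ be the Belavkin--Staszewski Radon--Nikodym derivative of $\rho_1$ with respect to $\rho_0$. Then $M_0$ is sufficient for $\{\rho_0,\rho_1\}$ if and only if $d_{\rho_0,\rho_1}\in F_{\rho_0}$. -/

import Mathlib

open scoped CStarAlgebra InnerProductSpace ComplexOrder

namespace QSuff

set_option linter.unusedSectionVars false

noncomputable section

variable {H : Type*} [NormedAddCommGroup H] [InnerProductSpace ℂ H] [FiniteDimensional ℂ H]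
  [CompleteSpace H]

/-- The algebra `B(H)` of all operators on the finite dimensional Hilbert space `H`. -/
abbrev Op (H : Type*) [NormedAddCommGroup H] [InnerProductSpace ℂ H] := H →L[ℂ] H

/-- The (unnormalised) trace `Tr` on `B(H)`. -/
def tr : Op H →ₗ[ℂ] ℂ := LinearMap.trace ℂ H ∘ₗ ContinuousLinearMap.coeLM ℂ

theorem tr_mul_comm (x y : Op H) : tr (x * y) = tr (y * x) :=
  LinearMap.trace_mul_comm ℂ (x : H →ₗ[ℂ] H) (y : H →ₗ[ℂ] H)

theorem tr_eq_sum {ι : Type*} [Fintype ι] (b : OrthonormalBasis ι ℂ H) (x : Op H) :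
    tr x = ∑ i, ⟪b i, x (b i)⟫_ℂ :=
  LinearMap.trace_eq_sum_inner (x : H →ₗ[ℂ] H) b

theorem tr_star_mul_self (x : Op H) :
    tr (star x * x) = ((∑ i, ‖x (stdOrthonormalBasis ℂ H i)‖ ^ 2 : ℝ) : ℂ) := by
  rw [tr_eq_sum (stdOrthonormalBasis ℂ H)]
  push_cast
  refine Finset.sum_congr rfl fun i _ => ?_
  change ⟪_, ContinuousLinearMap.adjoint x (x _)⟫_ℂ = _
  rw [ContinuousLinearMap.adjoint_inner_right]
  exact inner_self_eq_norm_sq_to_K _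

theorem tr_star_mul_self_nonneg (x : Op H) : 0 ≤ tr (star x * x) := by
  rw [tr_star_mul_self, Complex.zero_le_real]
  positivity

theorem eq_zero_of_tr_star_mul_self {x : Op H} (hx : tr (star x * x) = 0) : x = 0 := by
  rw [tr_star_mul_self, Complex.ofReal_eq_zero,
    Finset.sum_eq_zero_iff_of_nonneg (fun i _ => by positivity)] at hx
  have h : (x : H →ₗ[ℂ] H) = 0 := (stdOrthonormalBasis ℂ H).toBasis.ext fun i => by
    simpa using hx i (Finset.mem_univ i)
  exact ContinuousLinearMap.coe_injective h

/-! A unital `*`-subalgebra `M₀` of `B(H)` is a C*-algebra, ordered by the operator order. -/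

instance isClosed_starSubalgebra (M₀ : StarSubalgebra ℂ (Op H)) : IsClosed (M₀ : Set (Op H)) :=
  Submodule.closed_of_finiteDimensional M₀.toSubalgebra.toSubmodule

instance finiteDimensional_starSubalgebra (M₀ : StarSubalgebra ℂ (Op H)) :
    FiniteDimensional ℂ M₀ :=
  FiniteDimensional.finiteDimensional_submodule M₀.toSubalgebra.toSubmodule

instance starOrderedRing_starSubalgebra (M₀ : StarSubalgebra ℂ (Op H)) : StarOrderedRing M₀ := by
  refine StarOrderedRing.of_nonneg_iff' (fun {x y} h z => ?_) fun x => ⟨fun hx => ?_, ?_⟩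
  · exact add_le_add_right (α := Op H) h z
  · have hx' : 0 ≤ (x : Op H) := hx
    have hsa : IsSelfAdjoint x := Subtype.ext (IsSelfAdjoint.of_nonneg hx').star_eq
    have hsp : SpectrumRestricts x ContinuousMap.realToNNReal := by
      rw [SpectrumRestricts.nnreal_iff]
      intro c hc
      refine spectrum_nonneg_of_nonneg (𝕜 := ℝ) hx' (x := c) ?_
      intro hu
      exact hc ((StarSubalgebra.coe_isUnit M₀ (a := algebraMap ℝ M₀ c - x)).1 hu)
    obtain ⟨p, hp, -, hpx⟩ :=
      CFC.exists_sqrt_of_isSelfAdjoint_of_quasispectrumRestricts hsa hsp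
    exact ⟨p, by rw [hp.star_eq, hpx]⟩
  · rintro ⟨s, rfl⟩
    exact star_mul_self_nonneg (s : Op H)

/-! ### The trace preserving conditional expectation -/

/-- `⟨x, y⟩ ↦ Tr x y` as a bilinear form on `M₀`. -/
def trForm (M₀ : StarSubalgebra ℂ (Op H)) : LinearMap.BilinForm ℂ M₀ :=
  LinearMap.mk₂ ℂ (fun x y => tr ((x : Op H) * (y : Op H)))
    (by simp [add_mul]) (by simp) (by simp [mul_add]) (by simp)

theorem trForm_nondegenerate (M₀ : StarSubalgebra ℂ (Op H)) : (trForm M₀).Nondegenerate := by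
  constructor
  · intro x hx
    refine Subtype.ext (eq_zero_of_tr_star_mul_self ?_)
    rw [tr_mul_comm]
    exact hx (star x)
  · intro x hx
    exact Subtype.ext (eq_zero_of_tr_star_mul_self (hx (star x)))

/-- The trace preserving conditional expectation `E : B(H) → M₀`: `E Y` is the element of `M₀`
representing the functional `x ↦ Tr x Y` on `M₀`, that is, `Tr x E(Y) = Tr x Y` for `x ∈ M₀`. -/
def condExp (M₀ : StarSubalgebra ℂ (Op H)) : Op H →ₗ[ℂ] M₀ :=
  ((trForm M₀).toDual (trForm_nondegenerate M₀)).symm.toLinearMap ∘ₗ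
    LinearMap.mk₂ ℂ (fun (Y : Op H) (x : M₀) => tr (Y * (x : Op H)))
      (by simp [add_mul]) (by simp) (by simp [mul_add]) (by simp)

theorem tr_mul_condExp (M₀ : StarSubalgebra ℂ (Op H)) (x : M₀) (Y : Op H) :
    tr ((x : Op H) * (condExp M₀ Y : Op H)) = tr ((x : Op H) * Y) := by
  rw [tr_mul_comm, tr_mul_comm _ Y]
  exact LinearMap.BilinForm.apply_toDual_symm_apply (hB := trForm_nondegenerate M₀) _ _

theorem ext_of_tr {M₀ : StarSubalgebra ℂ (Op H)} {y z : M₀}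
    (h : ∀ x : M₀, tr ((x : Op H) * (y : Op H)) = tr ((x : Op H) * (z : Op H))) : y = z := by
  rw [← sub_eq_zero]
  refine Subtype.ext (eq_zero_of_tr_star_mul_self ?_)
  have := h (star (y - z))
  rw [← sub_eq_zero, ← map_sub, ← mul_sub] at this
  exact this

theorem condExp_coe (M₀ : StarSubalgebra ℂ (Op H)) (x : M₀) : condExp M₀ (x : Op H) = x :=
  ext_of_tr fun y => tr_mul_condExp M₀ y x

theorem tr_condExp (M₀ : StarSubalgebra ℂ (Op H)) (Y : Op H) :
    tr (condExp M₀ Y : Op H) = tr Y := by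
  simpa using tr_mul_condExp M₀ 1 Y

theorem condExp_mul_mul (M₀ : StarSubalgebra ℂ (Op H)) (x y : M₀) (Y : Op H) :
    condExp M₀ ((x : Op H) * Y * (y : Op H)) = x * condExp M₀ Y * y := by
  refine ext_of_tr fun z => ?_
  have h := tr_mul_condExp M₀ (y * z * x) Y
  have h1 := tr_mul_comm (y : Op H) ((z : Op H) * x * condExp M₀ Y)
  have h2 := tr_mul_comm (y : Op H) ((z : Op H) * x * Y)
  rw [tr_mul_condExp]
  simp only [MulMemClass.coe_mul, mul_assoc] at h h1 h2 ⊢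
  rw [← h1, ← h2, h]

theorem tr_nonneg {x : Op H} (hx : 0 ≤ x) : 0 ≤ tr x := by
  obtain ⟨b, rfl⟩ := CStarAlgebra.nonneg_iff_eq_star_mul_self.1 hx
  exact tr_star_mul_self_nonneg b

theorem eq_zero_of_tr {x : Op H} (hx : 0 ≤ x) (h : tr x = 0) : x = 0 := by
  obtain ⟨b, rfl⟩ := CStarAlgebra.nonneg_iff_eq_star_mul_self.1 hx
  simp [eq_zero_of_tr_star_mul_self h]

theorem condExp_star (M₀ : StarSubalgebra ℂ (Op H)) {Y : Op H} (hY : IsSelfAdjoint Y) :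
    IsSelfAdjoint (condExp M₀ Y) := by
  have tr_star (x : Op H) : tr (star x) = star (tr x) := by
    rw [tr_eq_sum (stdOrthonormalBasis ℂ H), tr_eq_sum (stdOrthonormalBasis ℂ H), star_sum]
    refine Finset.sum_congr rfl fun i _ => ?_
    rw [ContinuousLinearMap.star_eq_adjoint, ContinuousLinearMap.adjoint_inner_right]
    exact (inner_conj_symm _ _).symm
  refine ext_of_tr fun x => ?_
  have h := congrArg star (tr_mul_condExp M₀ (star x) Y)
  rw [← tr_star, ← tr_star, star_mul, star_mul, hY.star_eq, tr_mul_comm, tr_mul_comm Y] at h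
  simpa [tr_mul_condExp] using h

theorem condExp_nonneg (M₀ : StarSubalgebra ℂ (Op H)) {Y : Op H} (hY : 0 ≤ Y) :
    0 ≤ condExp M₀ Y := by
  have hsa := condExp_star M₀ (IsSelfAdjoint.of_nonneg hY)
  rw [CStarAlgebra.nonneg_iff_isSelfAdjoint_and_negPart_eq_zero]
  refine ⟨hsa, ?_⟩
  set a := condExp M₀ Y with ha
  have hn : 0 ≤ a⁻ := CFC.negPart_nonneg a
  obtain ⟨m, hm, hmn⟩ := CStarAlgebra.nonneg_iff_exists_isSelfAdjoint_and_eq_mul_self.1 hn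
  have hns : IsSelfAdjoint a⁻ := IsSelfAdjoint.of_nonneg hn
  have h1 : a⁻ * a * a⁻ = -(star (m * a⁻) * (m * a⁻)) := by
    have h2 : a⁻ * a = -(a⁻ * a⁻) := by
      nth_rewrite 2 [← CFC.posPart_sub_negPart a hsa]
      rw [mul_sub, CFC.negPart_mul_posPart, zero_sub]
    rw [h2, neg_mul, star_mul, hns.star_eq, hm.star_eq]
    nth_rewrite 2 [hmn]
    simp only [mul_assoc]
  generalize a⁻ = n at *
  have h3 : 0 ≤ tr ((n * a * n : M₀) : Op H) := by
    rw [ha, ← condExp_mul_mul, tr_condExp]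
    have hns' : IsSelfAdjoint (n : Op H) := Subtype.ext_iff.1 hns.star_eq
    exact tr_nonneg (hns'.conjugate_nonneg hY)
  rw [h1] at h3
  have h4 : m * n = 0 := by
    refine Subtype.ext (eq_zero_of_tr_star_mul_self (le_antisymm ?_ (tr_star_mul_self_nonneg _)))
    have h5 : 0 ≤ tr (-(star (((m * n : M₀)) : Op H) * ((m * n : M₀) : Op H))) := h3
    rw [map_neg] at h5
    exact neg_nonneg.1 h5
  have h5 : star n * n = 0 := by
    rw [hns.star_eq]
    nth_rewrite 1 [hmn]
    rw [mul_assoc, h4, mul_zero]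
  refine Subtype.ext (eq_zero_of_tr_star_mul_self ?_)
  have h6 := congrArg (fun z : M₀ => tr (z : Op H)) h5
  simpa using h6

theorem condExp_isUnit (M₀ : StarSubalgebra ℂ (Op H)) {Y : Op H} (hY : 0 ≤ Y) (hu : IsUnit Y) :
    IsUnit (condExp M₀ Y) := by
  obtain ⟨b, hb, rfl⟩ := CStarAlgebra.isStrictlyPositive_iff_eq_star_mul_self.1
    (hu.isStrictlyPositive hY)
  have hinj : Function.Injective (LinearMap.mulLeft ℂ (condExp M₀ (star b * b))) := by
    rw [injective_iff_map_eq_zero]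
    intro x hx
    have h1 : tr (((star x : M₀) : Op H) * (star b * b) * (x : Op H)) = 0 := by
      rw [← tr_condExp M₀, condExp_mul_mul, mul_assoc]
      rw [LinearMap.mulLeft_apply] at hx
      simp [hx]
    have h2 : b * (x : Op H) = 0 := by
      refine eq_zero_of_tr_star_mul_self ?_
      rw [← h1]
      simp [mul_assoc]
    exact Subtype.ext (hb.mul_right_eq_zero.1 h2)
  obtain ⟨z, hz⟩ := LinearMap.injective_iff_surjective.1 hinj 1
  have hsa := condExp_star M₀ (IsSelfAdjoint.of_nonneg hY)
  have hz' : star z * condExp M₀ (star b * b) = 1 := by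
    have := congrArg star hz
    rwa [LinearMap.mulLeft_apply, star_mul, hsa.star_eq, star_one] at this
  exact isUnit_iff_exists.2 ⟨z, hz, by rwa [← left_inv_eq_right_inv hz' hz]⟩

/-! ### Densities, the generalized conditional expectation, the Radon-Nikodym derivative -/

/-- `ρ` is a density operator: positive with trace one. -/
structure IsDensity (ρ : Op H) : Prop where
  nonneg : 0 ≤ ρ
  tr_eq_one : tr ρ = 1

/-- The form `⟨X, Y⟩_ρ = Tr X* ρ^{1/2} Y ρ^{1/2}`. -/
def rhoInner (ρ X Y : Op H) : ℂ :=
  tr (star X * ρ ^ (1 / 2 : ℝ) * Y * ρ ^ (1 / 2 : ℝ))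

/-- The generalized conditional expectation
`E_ρ(X) = E(ρ)^{-1/2} E(ρ^{1/2} X ρ^{1/2}) E(ρ)^{-1/2}` from `B(H)` to `M₀`. For an invertible
density `ρ` it is the map with `⟨X₀, Y⟩_ρ = ⟨X₀, E_ρ(Y)⟩_{E(ρ)}` for `X₀ ∈ M₀`, `Y ∈ B(H)`,
see `eq_genCondExp_iff`. -/
def genCondExp (M₀ : StarSubalgebra ℂ (Op H)) (ρ : Op H) : Op H →ₗ[ℂ] M₀ :=
  LinearMap.mulLeftRight ℂ (condExp M₀ ρ ^ (-(1 / 2) : ℝ), condExp M₀ ρ ^ (-(1 / 2) : ℝ)) ∘ₗ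
    condExp M₀ ∘ₗ LinearMap.mulLeftRight ℂ (ρ ^ (1 / 2 : ℝ), ρ ^ (1 / 2 : ℝ))

theorem genCondExp_apply (M₀ : StarSubalgebra ℂ (Op H)) (ρ X : Op H) :
    genCondExp M₀ ρ X = condExp M₀ ρ ^ (-(1 / 2) : ℝ) *
      condExp M₀ (ρ ^ (1 / 2 : ℝ) * X * ρ ^ (1 / 2 : ℝ)) * condExp M₀ ρ ^ (-(1 / 2) : ℝ) := by
  simp [genCondExp]

/-- The Belavkin-Staszewski Radon-Nikodym derivative
`d_{ρ₀,ρ₁} = ρ₀^{-1/2} ρ₁ ρ₀^{-1/2}` of `ρ₁` with respect to `ρ₀`. -/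
def rnDeriv (ρ₀ ρ₁ : Op H) : Op H :=
  ρ₀ ^ (-(1 / 2) : ℝ) * ρ₁ * ρ₀ ^ (-(1 / 2) : ℝ)

theorem sqrt_mul_sqrt {A : Type*} [CStarAlgebra A] [PartialOrder A] [StarOrderedRing A] {a : A}
    (ha : 0 ≤ a) (hu : IsUnit a) : a ^ (1 / 2 : ℝ) * a ^ (1 / 2 : ℝ) = a := by
  rw [← CFC.rpow_add hu, add_halves, CFC.rpow_one a]

theorem coe_rpow_half (M₀ : StarSubalgebra ℂ (Op H)) {a : M₀} (ha : 0 ≤ a) :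
    ((a ^ (1 / 2 : ℝ) : M₀) : Op H) = (a : Op H) ^ (1 / 2 : ℝ) := by
  rw [← CFC.sqrt_eq_rpow, ← CFC.sqrt_eq_rpow]
  symm
  apply CFC.sqrt_unique
  · rw [← MulMemClass.coe_mul, CFC.sqrt_mul_sqrt_self a ha]
  · exact (CFC.sqrt_nonneg a : 0 ≤ CFC.sqrt a)

/-- `E_ρ(Y)` is the unique `Z ∈ M₀` with `⟨X₀, Y⟩_ρ = ⟨X₀, Z⟩_{E(ρ)}` for all `X₀ ∈ M₀`. -/
theorem eq_genCondExp_iff (M₀ : StarSubalgebra ℂ (Op H)) {ρ : Op H} (hρ : 0 ≤ ρ) (hu : IsUnit ρ)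
    (Y : Op H) (Z : M₀) :
    Z = genCondExp M₀ ρ Y ↔
      ∀ X₀ : M₀, rhoInner ρ X₀ Y = rhoInner (condExp M₀ ρ : Op H) X₀ Z := by
  have hE := condExp_nonneg M₀ hρ
  have hEp := (condExp_isUnit M₀ hρ hu).isStrictlyPositive hE
  have key (X₀ : M₀) : rhoInner ρ X₀ Y = rhoInner (condExp M₀ ρ : Op H) X₀ Z ↔
      tr (((star X₀ : M₀) : Op H) * (condExp M₀ (ρ ^ (1 / 2 : ℝ) * Y * ρ ^ (1 / 2 : ℝ)) : Op H)) =
      tr (((star X₀ : M₀) : Op H) * ((condExp M₀ ρ ^ (1 / 2 : ℝ) * Z *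
        condExp M₀ ρ ^ (1 / 2 : ℝ) : M₀) : Op H)) := by
    rw [tr_mul_condExp]
    simp only [rhoInner, ← coe_rpow_half M₀ hE, mul_assoc, MulMemClass.coe_mul,
      StarMemClass.coe_star]
  have h1 := CFC.rpow_neg_mul_rpow (a := condExp M₀ ρ) (1 / 2) hEp
  have h2 := CFC.rpow_mul_rpow_neg (a := condExp M₀ ρ) (1 / 2) hEp
  simp only [key, genCondExp_apply]
  generalize condExp M₀ ρ ^ (1 / 2 : ℝ) = s at *
  generalize condExp M₀ ρ ^ (-(1 / 2) : ℝ) = r at *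
  constructor
  · rintro rfl X₀
    congr 3
    calc _ = s * r * condExp M₀ (ρ ^ (1 / 2 : ℝ) * Y * ρ ^ (1 / 2 : ℝ)) * (r * s) := by
          rw [h1, h2, one_mul, mul_one]
      _ = _ := by simp only [mul_assoc]
  · intro h
    have h3 : condExp M₀ (ρ ^ (1 / 2 : ℝ) * Y * ρ ^ (1 / 2 : ℝ)) = s * Z * s :=
      ext_of_tr fun x => by simpa using h (star x)
    rw [h3]
    calc Z = r * s * Z * (s * r) := by rw [h1, h2, one_mul, mul_one]
      _ = _ := by simp only [mul_assoc]

/-- `d_{ρ₀,ρ₁}` is the unique `D ∈ B(H)` with `Tr ρ₁ X = ⟨X*, D⟩_{ρ₀}` for all `X ∈ B(H)`. -/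
theorem eq_rnDeriv_iff {ρ₀ : Op H} (h₀ : 0 ≤ ρ₀) (hu : IsUnit ρ₀) (ρ₁ D : Op H) :
    D = rnDeriv ρ₀ ρ₁ ↔ ∀ X : Op H, tr (ρ₁ * X) = rhoInner ρ₀ (star X) D := by
  have hp := hu.isStrictlyPositive h₀
  have h1 := CFC.rpow_neg_mul_rpow (a := ρ₀) (1 / 2) hp
  have h2 := CFC.rpow_mul_rpow_neg (a := ρ₀) (1 / 2) hp
  simp only [rhoInner, rnDeriv, star_star]
  generalize ρ₀ ^ (1 / 2 : ℝ) = s at *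
  generalize ρ₀ ^ (-(1 / 2) : ℝ) = r at *
  constructor
  · rintro rfl X
    rw [tr_mul_comm]
    congr 1
    calc X * ρ₁ = X * (s * r) * ρ₁ * (r * s) := by rw [h1, h2, mul_one, mul_one]
      _ = _ := by simp only [mul_assoc]
  · intro h
    have h3 : ρ₁ - s * D * s = 0 := by
      refine eq_zero_of_tr_star_mul_self ?_
      have := h (star (ρ₁ - s * D * s))
      rw [tr_mul_comm, ← sub_eq_zero, ← map_sub] at this
      rw [← this]
      simp only [mul_sub, mul_assoc]
    rw [sub_eq_zero.1 h3]
    calc D = r * s * D * (s * r) := by rw [h1, h2, one_mul, mul_one]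
      _ = _ := by simp only [mul_assoc]

/-- `F_ρ`, the set of fixed points of `E_ρ`. -/
def fixedPoints (M₀ : StarSubalgebra ℂ (Op H)) (ρ : Op H) : Set (Op H) :=
  {X | (genCondExp M₀ ρ X : Op H) = X}

/-- `M₀` is sufficient for `{ρ₀, ρ₁}`: there is a completely positive trace preserving map
`T : M₀ → B(H)` with `T (E ρ₀) = ρ₀` and `T (E ρ₁) = ρ₁`. -/
def IsSufficient (M₀ : StarSubalgebra ℂ (Op H)) (ρ₀ ρ₁ : Op H) : Prop :=
  ∃ T : M₀ →CP Op H, (∀ x : M₀, tr (T x) = tr (x : Op H)) ∧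
    T (condExp M₀ ρ₀) = ρ₀ ∧ T (condExp M₀ ρ₁) = ρ₁

end

end QSuff

namespace QSuff

set_option linter.unusedSectionVars false

variable {H : Type*} [NormedAddCommGroup H] [InnerProductSpace ℂ H] [FiniteDimensional ℂ H]
  [CompleteSpace H]

/-! ### The trace as a Hilbert-Schmidt inner product -/

/-! Write `r`, `a` for `ρ₀^{1/2}`, `ρ₀^{-1/2}` and `s`, `t` for `E(ρ₀)^{1/2}`, `E(ρ₀)^{-1/2}`. Since
`r d r = ρ₁`, the fixed point condition reads `t E(ρ₁) t = a ρ₁ a`. If it holds, the Petz map `x ↦ r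
t x t r` recovers both states (`exists_recovery`).

Conversely, the form `Tr x* a x a` is monotone: `E` does not increase it (with `t` in place of `a`
on the image), and neither does the recovery map `T` on the way back. Sufficiency thus forces
equality at `ρ₁`, and the equality case of the contraction `E` says that `ρ₁` is fixed by the
adjoint of `E` composed with `E`, which is the claim (`eq_of_sufficient`).

Monotonicity is first proved for the one-sided form `Tr x* ρ⁻¹ x`, by completing a square for `E`
(`hsSq_condExp_le`) and by a Schwarz inequality for `T` (`hsSq_completelyPositive_le`). Taking
adjoints gives the form `Tr x ρ⁻¹ x*`, and `sandwich_contraction` interpolates between the two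
without complex interpolation. -/

theorem tr_star (x : Op H) : tr (star x) = star (tr x) := by
  rw [tr_eq_sum (stdOrthonormalBasis ℂ H), tr_eq_sum (stdOrthonormalBasis ℂ H), star_sum]
  refine Finset.sum_congr rfl fun i _ => ?_
  rw [ContinuousLinearMap.star_eq_adjoint, ContinuousLinearMap.adjoint_inner_right]
  exact (inner_conj_symm _ _).symm

theorem re_tr_star (x : Op H) : (tr (star x)).re = (tr x).re := by
  rw [tr_star]; rfl

theorem condExp_star_apply (M₀ : StarSubalgebra ℂ (Op H)) (Y : Op H) :
    condExp M₀ (star Y) = star (condExp M₀ Y) := by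
  refine ext_of_tr fun x => ?_
  have h := congrArg star (tr_mul_condExp M₀ (star x) Y)
  rw [← tr_star, ← tr_star, star_mul, star_mul, tr_mul_comm, tr_mul_comm (star Y)] at h
  simpa [tr_mul_condExp] using h.symm

/-- The squared Hilbert-Schmidt norm. -/
noncomputable def hsSq (x : Op H) : ℝ := (tr (star x * x)).re

theorem hsSq_nonneg (x : Op H) : 0 ≤ hsSq x :=
  (Complex.le_def.1 (tr_star_mul_self_nonneg x)).1

theorem eq_zero_of_hsSq {x : Op H} (hx : hsSq x ≤ 0) : x = 0 := by
  refine eq_zero_of_tr_star_mul_self (Complex.ext (le_antisymm hx (hsSq_nonneg x)) ?_)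
  exact (Complex.le_def.1 (tr_star_mul_self_nonneg x)).2.symm

theorem hsSq_star (x : Op H) : hsSq (star x) = hsSq x := by
  rw [hsSq, star_star, tr_mul_comm]; rfl

theorem re_tr_star_mul_comm (x y : Op H) : (tr (star x * y)).re = (tr (star y * x)).re := by
  rw [← re_tr_star, star_mul, star_star]

theorem hsSq_sub (x y : Op H) :
    hsSq (x - y) = hsSq x - 2 * (tr (star x * y)).re + hsSq y := by
  have h := re_tr_star_mul_comm x y
  simp only [hsSq, star_sub, sub_mul, mul_sub, map_sub, Complex.sub_re]
  linarith

theorem two_mul_re_tr_le (x y : Op H) : 2 * (tr (star x * y)).re ≤ hsSq x + hsSq y := by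
  have := hsSq_nonneg (x - y)
  rw [hsSq_sub] at this
  linarith

/-- Riesz representation, from nondegeneracy of the trace form on the full algebra. -/
theorem exists_tr_mul_eq (f : Op H →ₗ[ℂ] ℂ) : ∃ z : Op H, ∀ y, tr (z * y) = f y := by
  let e := (trForm (⊤ : StarSubalgebra ℂ (Op H))).toDual (trForm_nondegenerate _)
  let g : (⊤ : StarSubalgebra ℂ (Op H)) →ₗ[ℂ] ℂ :=
    f ∘ₗ (⊤ : StarSubalgebra ℂ (Op H)).subtype.toAlgHom.toLinearMap
  refine ⟨(e.symm g : _), fun y => ?_⟩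
  exact LinearMap.BilinForm.apply_toDual_symm_apply
    (hB := trForm_nondegenerate (⊤ : StarSubalgebra ℂ (Op H))) g ⟨y, trivial⟩

/-! ### Monotonicity of the form `Tr x* a y a` -/

/-- The form `Tr x* a y a`. -/
noncomputable def sandwich (a x y : Op H) : ℂ := tr (star x * a * y * a)

theorem exists_selfAdjoint_mul_self {a : Op H} (ha : 0 ≤ a) :
    ∃ b : Op H, star b = b ∧ a = b * b := by
  obtain ⟨b, hb, h⟩ := CStarAlgebra.nonneg_iff_exists_isSelfAdjoint_and_eq_mul_self.1 ha
  exact ⟨b, hb.star_eq, h⟩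

theorem sandwich_mul_self {b : Op H} (hb : star b = b) (x y : Op H) :
    sandwich (b * b) x y = tr (star (b * x * b) * (b * y * b)) := by
  rw [sandwich, ← mul_assoc (star x * (b * b) * y), tr_mul_comm]
  simp only [star_mul, hb, mul_assoc]

theorem sandwich_self {b : Op H} (hb : star b = b) (x : Op H) :
    (sandwich (b * b) x x).re = hsSq (b * x * b) := by
  rw [sandwich_mul_self hb, hsSq]

theorem sandwich_left {a : Op H} (ha : star a = a) (x y : Op H) :
    sandwich a x y = tr (star (a * x) * (y * a)) := by
  simp only [sandwich, star_mul, ha, mul_assoc]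

theorem sandwich_right {a : Op H} (ha : star a = a) (x y : Op H) :
    sandwich a x y = tr (star (x * a) * (a * y)) := by
  rw [sandwich, tr_mul_comm]
  simp only [star_mul, ha, mul_assoc]

theorem re_sandwich_comm {a : Op H} (ha : star a = a) (x y : Op H) :
    (sandwich a x y).re = (sandwich a y x).re := by
  rw [sandwich_left ha, sandwich_right ha, re_tr_star_mul_comm]

theorem sandwich_self_nonneg {a : Op H} (ha : 0 ≤ a) (x : Op H) : 0 ≤ (sandwich a x x).re := by
  obtain ⟨b, hb, rfl⟩ := exists_selfAdjoint_mul_self ha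
  rw [sandwich_self hb]
  exact hsSq_nonneg _

theorem sandwich_sub_self {a : Op H} (ha : star a = a) (x y : Op H) :
    (sandwich a (x - y) (x - y)).re =
      (sandwich a x x).re - 2 * (sandwich a x y).re + (sandwich a y y).re := by
  have h := re_sandwich_comm ha x y
  simp only [sandwich, star_sub, sub_mul, mul_sub, map_sub, Complex.sub_re] at h ⊢
  linarith

theorem two_mul_re_sandwich_le {a : Op H} (ha : 0 ≤ a) (x y : Op H) :
    2 * (sandwich a x y).re ≤ (sandwich a x x).re + (sandwich a y y).re := by
  have := sandwich_self_nonneg ha (x - y)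
  rw [sandwich_sub_self (IsSelfAdjoint.of_nonneg ha).star_eq] at this
  linarith

/-- A bounded convex sequence is nonincreasing at its start. -/
theorem le_of_convex_of_bounded {b : ℕ → ℝ} {C : ℝ} (hC : ∀ n, b n ≤ C)
    (hb : ∀ n, 2 * b (n + 1) ≤ b n + b (n + 2)) : b 1 ≤ b 0 := by
  by_contra! h
  have hstep (n : ℕ) : b 1 - b 0 ≤ b (n + 1) - b n := by
    induction n with
    | zero => exact le_rfl
    | succ n ih => linarith [hb n]
  have hgrow (n : ℕ) : b 0 + n * (b 1 - b 0) ≤ b n := by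
    induction n with
    | zero => simp
    | succ n ih => push_cast; linarith [hstep n]
  obtain ⟨n, hn⟩ := exists_nat_gt ((C - b 0) / (b 1 - b 0))
  rw [div_lt_iff₀ (by linarith)] at hn
  linarith [hgrow n, hC n]

/-- If a `*`-preserving map contracts `Tr x* a² x`, it contracts `Tr x* a x a`. -/
theorem sandwich_contraction (Φ : Op H →ₗ[ℂ] Op H) (hΦ : ∀ x, Φ (star x) = star (Φ x))
    {a a' i : Op H} (ha : 0 ≤ a) (ha' : 0 ≤ a') (hai : a * i = 1) (hia : i * a = 1)
    (h : ∀ x, hsSq (a' * Φ x) ≤ hsSq (a * x)) (x : Op H) :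
    (sandwich a' (Φ x) (Φ x)).re ≤ (sandwich a x x).re := by
  have hsa := (IsSelfAdjoint.of_nonneg ha).star_eq
  have hsa' := (IsSelfAdjoint.of_nonneg ha').star_eq
  have hR (x : Op H) : hsSq (Φ x * a') ≤ hsSq (x * a) := by
    have := h (star x)
    rwa [hΦ, ← hsSq_star, ← hsSq_star (a * _), star_mul, star_mul, star_star, star_star, hsa,
      hsa'] at this
  -- `S` is `Φ` followed by its adjoint for the sandwich forms. If `w` represents the right-hand
  -- functional under the trace, `a z* a = w` forces `z* = i w i`.
  have hS (x : Op H) : ∃ z, ∀ y, sandwich a z y = sandwich a' (Φ x) (Φ y) := by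
    obtain ⟨w, hw⟩ := exists_tr_mul_eq
      (tr ∘ₗ LinearMap.mulLeft ℂ (a' * star (Φ x) * a') ∘ₗ Φ)
    refine ⟨star (i * w * i), fun y => ?_⟩
    have hw' := hw y
    simp only [LinearMap.comp_apply, LinearMap.mulLeft_apply] at hw'
    rw [sandwich, sandwich, star_star, tr_mul_comm, tr_mul_comm _ a']
    have e : a * (i * w * i * a * y) = w * y := by
      calc _ = (a * i) * w * (i * a) * y := by simp only [mul_assoc]
        _ = _ := by rw [hai, hia, one_mul, mul_one]
    rw [e, hw']
    simp only [mul_assoc]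
  choose S hS using hS
  have hSL (x : Op H) : hsSq (a * S x) ≤ hsSq (a * x) := by
    -- The test vector `y = a (S x) i` satisfies `y a = a (S x)`, so pairing it with `S x` gives
    -- `hsSq (a * S x)`. On the `Φ` side the pairing splits into a left norm of `Φ x` and a right
    -- norm of `Φ y`.
    have h1 := hS x (a * S x * i)
    have h2 := two_mul_re_tr_le (a' * Φ x) (Φ (a * S x * i) * a')
    rw [← sandwich_left hsa', ← h1, sandwich_left hsa, mul_assoc _ i, hia, mul_one] at h2
    have h3 := hR (a * S x * i)
    rw [mul_assoc _ i, hia, mul_one] at h3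
    have h4 := h x
    rw [← hsSq] at h2
    linarith
  have hSR (x : Op H) : hsSq (S x * a) ≤ hsSq (x * a) := by
    have h1 := hS x (i * (S x * a))
    have h2 := two_mul_re_tr_le (Φ x * a') (a' * Φ (i * (S x * a)))
    rw [← sandwich_right hsa', ← h1, sandwich_right hsa, ← mul_assoc a i, hai, one_mul] at h2
    have h3 := h (i * (S x * a))
    rw [← mul_assoc a i, hai, one_mul] at h3
    have h4 := hR x
    rw [← hsSq] at h2
    linarith
  have hbound (n : ℕ) : hsSq (a * S^[n] x) ≤ hsSq (a * x) ∧ hsSq (S^[n] x * a) ≤ hsSq (x * a) := by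
    induction n with
    | zero => exact ⟨le_rfl, le_rfl⟩
    | succ n ih =>
      rw [Function.iterate_succ_apply']
      exact ⟨(hSL _).trans ih.1, (hSR _).trans ih.2⟩
  have hmono : (sandwich a (S x) (S x)).re ≤ (sandwich a x x).re := by
    refine le_of_convex_of_bounded (b := fun n => (sandwich a (S^[n] x) (S^[n] x)).re)
      (C := (hsSq (a * x) + hsSq (x * a)) / 2) (fun n => ?_) (fun n => ?_)
    · have := two_mul_re_tr_le (a * S^[n] x) (S^[n] x * a)
      rw [← sandwich_left hsa] at this
      linarith [(hbound n).1, (hbound n).2]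
    · have h1 := two_mul_re_sandwich_le ha (S^[n] x) (S^[n + 2] x)
      have h2 : (sandwich a (S^[n] x) (S^[n + 2] x)).re =
          (sandwich a (S^[n + 1] x) (S^[n + 1] x)).re := by
        rw [re_sandwich_comm hsa, Function.iterate_succ_apply', hS, re_sandwich_comm hsa', ← hS,
          ← Function.iterate_succ_apply' S]
      rw [h2] at h1
      exact h1
  have := two_mul_re_sandwich_le ha (S x) x
  rw [hS] at this
  linarith

/-! ### Contraction of `Tr x* ρ⁻¹ x` -/

/-- Here `a = ρ^{-1/2}`, `r = ρ^{1/2}`, `s = E(ρ)^{1/2}` and `t = E(ρ)^{-1/2}`. -/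
theorem hsSq_condExp_le (M₀ : StarSubalgebra ℂ (Op H)) {a r : Op H} {s t : M₀}
    (hr : star r = r) (hs : star s = s) (ht : star t = t) (har : a * r = 1)
    (ha : star a = a) (hst : s * t = 1) (hE : condExp M₀ (r * r) = s * s) (x : Op H) :
    hsSq ((t : Op H) * (condExp M₀ x : Op H)) ≤ hsSq (a * x) := by
  set e := condExp M₀ x with he
  -- The subtracted term is `ρ^{1/2} E(ρ)⁻¹ E(x)`. Its squared norm and its pairing with `a x` both
  -- equal the squared norm of `t E(x)`.
  have h0 := hsSq_nonneg (a * x - r * ((t * t * e : M₀) : Op H))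
  have h1 : tr (star (a * x) * (r * ((t * t * e : M₀) : Op H))) =
      tr (star ((t * e : M₀) : Op H) * ((t * e : M₀) : Op H)) := by
    have h := tr_mul_condExp M₀ (t * t * e) (star x)
    rw [condExp_star_apply, ← he, tr_mul_comm, tr_mul_comm _ (star x)] at h
    have e1 : star (a * x) * (r * ((t * t * e : M₀) : Op H)) =
        star x * ((t * t * e : M₀) : Op H) := by
      rw [star_mul, ha, mul_assoc, ← mul_assoc a, har, one_mul]
    have e2 : star ((t * e : M₀) : Op H) * ((t * e : M₀) : Op H) =
        ((star e : M₀) : Op H) * ((t * t * e : M₀) : Op H) := by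
      have : star (t * e) * (t * e) = star e * (t * t * e) := by
        rw [star_mul, ht]; simp only [mul_assoc]
      exact congrArg Subtype.val this
    rw [e1, e2, h]
  have h2 : hsSq (r * ((t * t * e : M₀) : Op H)) = hsSq ((t * e : M₀) : Op H) := by
    have h := tr_mul_condExp M₀ ((t * t * e) * star (t * t * e)) (r * r)
    have e1 : tr (star (r * ((t * t * e : M₀) : Op H)) * (r * ((t * t * e : M₀) : Op H))) =
        tr ((((t * t * e) * star (t * t * e) : M₀) : Op H) * (r * r)) := by
      rw [star_mul, hr, mul_assoc, tr_mul_comm, tr_mul_comm _ (r * r)]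
      simp only [mul_assoc, MulMemClass.coe_mul, StarMemClass.coe_star]
    have e2 : s * (t * t * e) = t * e := by
      rw [← mul_assoc, ← mul_assoc, hst, one_mul]
    have e3 : tr ((((t * t * e) * star (t * t * e) : M₀) : Op H) * ((s * s : M₀) : Op H)) =
        tr (star ((t * e : M₀) : Op H) * ((t * e : M₀) : Op H)) := by
      rw [tr_mul_comm, ← MulMemClass.coe_mul]
      have : s * s * (t * t * e * star (t * t * e)) = s * ((t * e) * star (t * t * e)) := by
        rw [← e2]; simp only [mul_assoc]
      rw [this, MulMemClass.coe_mul, tr_mul_comm, ← MulMemClass.coe_mul]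
      have : t * e * star (t * t * e) * s = (t * e) * star (t * e) := by
        nth_rewrite 3 [← e2]
        rw [star_mul s, hs, mul_assoc]
      rw [this, MulMemClass.coe_mul, tr_mul_comm]
      rfl
    rw [hsSq, e1, ← h, hE, e3]
    rfl
  rw [hsSq_sub, h1, h2, ← hsSq] at h0
  rw [← MulMemClass.coe_mul]
  linarith

/-! ### A Schwarz inequality from 2-positivity -/

section CompletelyPositive

variable {A : Type*} [CStarAlgebra A] [PartialOrder A] [StarOrderedRing A]

theorem exists_eq_star_mul_self {B : Type*} [NonUnitalCStarAlgebra B] [PartialOrder B]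
    [StarOrderedRing B] {x : B} (hx : 0 ≤ x) : ∃ b, x = star b * b :=
  CStarAlgebra.nonneg_iff_eq_star_mul_self.1 hx

theorem exists_map_star_mul_eq (T : A →CP Op H) (v₀ v₁ : A) :
    ∃ n : Fin 2 → Fin 2 → Op H, ∀ i j,
      T (star (![v₀, v₁] i) * ![v₀, v₁] j) = ∑ k, star (n k i) * n k j := by
  -- With `v₀, v₁` as its only nonzero row, `N* N` is the Gram matrix of the two.
  let N : CStarMatrix (Fin 2) (Fin 2) A := CStarMatrix.ofMatrix !![v₀, v₁; 0, 0]
  have hM := T.map_cstarMatrix_nonneg _ (star_mul_self_nonneg N)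
  obtain ⟨n, hn⟩ := exists_eq_star_mul_self hM
  refine ⟨n, fun i j => ?_⟩
  have h := congrFun (congrFun hn i) j
  rw [CStarMatrix.map_apply, CStarMatrix.mul_apply, CStarMatrix.mul_apply] at h
  simp only [CStarMatrix.star_apply] at h
  rw [← h, Fin.sum_univ_two]
  congr 1
  fin_cases i <;> fin_cases j <;> simp [N]

theorem map_star_mul_swap (T : A →CP Op H) (v₀ v₁ : A) :
    T (star v₁ * v₀) = star (T (star v₀ * v₁)) := by
  obtain ⟨n, hn⟩ := exists_map_star_mul_eq T v₀ v₁
  have h01 := hn 0 1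
  have h10 := hn 1 0
  simp only [Matrix.cons_val_zero, Matrix.cons_val_one] at h01 h10
  simp [h01, h10]

theorem completelyPositive_map_star (T : A →CP Op H) (x : A) : T (star x) = star (T x) := by
  simpa using map_star_mul_swap T 1 x

/-- The expression is the sum over `k` of the squared norms of `n k 1 - n k 0 * c`, where `n* n` is
the image of the Gram matrix. -/
theorem re_tr_block_nonneg (T : A →CP Op H) (v₀ v₁ : A) (c : Op H) :
    0 ≤ (tr (star c * T (star v₀ * v₀) * c)).re - 2 * (tr (star c * T (star v₀ * v₁))).re +
      (tr (T (star v₁ * v₁))).re := by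
  obtain ⟨n, hn⟩ := exists_map_star_mul_eq T v₀ v₁
  have h00 := hn 0 0
  have h01 := hn 0 1
  have h11 := hn 1 1
  simp only [Matrix.cons_val_zero, Matrix.cons_val_one, Fin.sum_univ_two] at h00 h01 h11
  have key (k : Fin 2) := hsSq_nonneg (n k 1 - n k 0 * c)
  have h0 := key 0
  have h1 := key 1
  rw [hsSq_sub, re_tr_star_mul_comm] at h0 h1
  simp only [h00, h01, h11, hsSq, star_mul, mul_add, add_mul, map_add, Complex.add_re,
    mul_assoc] at h0 h1 ⊢
  linarith

end CompletelyPositive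

/-- Here `a = ρ^{-1/2}`, `r = ρ^{1/2}` with `ρ = T(s²)`, and `t = s⁻¹`. -/
theorem hsSq_completelyPositive_le {M₀ : StarSubalgebra ℂ (Op H)} (T : M₀ →CP Op H)
    (hT : ∀ x : M₀, tr (T x) = tr (x : Op H)) {a r : Op H} {s t : M₀}
    (ha : star a = a) (hs : star s = s) (har : a * r = 1) (hra : r * a = 1)
    (hst : s * t = 1) (hTs : T (s * s) = r * r) (z : M₀) :
    hsSq (a * T z) ≤ hsSq ((t : Op H) * (z : Op H)) := by
  -- The optimal `c` is `T(s²)⁻¹ T(z)`, and `T(s²)⁻¹ = a²`.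
  have h := re_tr_block_nonneg T s (t * z) (a * a * T z)
  have e1 : star s * (t * z) = z := by rw [hs, ← mul_assoc, hst, one_mul]
  have e2 : star (a * a * T z) * T (star s * s) * (a * a * T z) = star (a * T z) * (a * T z) := by
    rw [hs, hTs]
    simp only [star_mul, ha]
    calc _ = star (T z) * a * (a * r) * (r * a) * a * T z := by simp only [mul_assoc]
      _ = _ := by rw [har, hra, mul_one, mul_one]; simp only [mul_assoc]
  have e3 : star (a * a * T z) * T z = star (a * T z) * (a * T z) := by
    simp only [star_mul, ha, mul_assoc]
  rw [e1, e2, e3, hT] at h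
  have e4 : (tr ((star (t * z) * (t * z) : M₀) : Op H)).re = hsSq ((t : Op H) * (z : Op H)) := by
    simp [hsSq]
  rw [e4, ← hsSq] at h
  linarith

/-! ### The Petz recovery map -/

/-- The compression `x ↦ c* x c` from `M₀` to `B(H)` as a completely positive map. -/
noncomputable def compression (M₀ : StarSubalgebra ℂ (Op H)) (c : Op H) : M₀ →CP Op H where
  toLinearMap := LinearMap.mulLeftRight ℂ (star c, c) ∘ₗ M₀.subtype.toAlgHom.toLinearMap
  map_cstarMatrix_nonneg' k M hM := by
    obtain ⟨N, rfl⟩ := exists_eq_star_mul_self hM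
    let N' : CStarMatrix (Fin k) (Fin k) (Op H) :=
      CStarMatrix.ofMatrix fun i j => (N i j : Op H) * c
    convert star_mul_self_nonneg N' using 1
    ext1 i j
    rw [CStarMatrix.map_apply, CStarMatrix.mul_apply, CStarMatrix.mul_apply]
    have hN' (i j) : N' i j = (N i j : Op H) * c := rfl
    simp [hN', CStarMatrix.star_apply, mul_assoc]

theorem compression_apply (M₀ : StarSubalgebra ℂ (Op H)) (c : Op H) (x : M₀) :
    compression M₀ c x = star c * (x : Op H) * c :=
  LinearMap.mulLeftRight_apply (R := ℂ) (star c) c (x : Op H)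

/-! ### Sufficiency -/

section Sufficiency

variable {M₀ : StarSubalgebra ℂ (Op H)} {a r : Op H} {s t : M₀}

/-- Here `a = ρ^{-1/2}`, `r = ρ^{1/2}`, `s = E(ρ)^{1/2}` and `t = E(ρ)^{-1/2}`. -/
theorem exists_recovery (hr : star r = r) (ht : star t = t)
    (hra : r * a = 1) (har : a * r = 1) (hst : s * t = 1) (hts : t * s = 1)
    (hE : condExp M₀ (r * r) = s * s) {ρ₁ : Op H}
    (h : ((t * condExp M₀ ρ₁ * t : M₀) : Op H) = a * ρ₁ * a) :
    ∃ T : M₀ →CP Op H, (∀ x : M₀, tr (T x) = tr (x : Op H)) ∧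
      T (condExp M₀ (r * r)) = r * r ∧ T (condExp M₀ ρ₁) = ρ₁ := by
  have key (x : M₀) : compression M₀ ((t : Op H) * r) x = r * ((t * x * t : M₀) : Op H) * r := by
    have ht' : star (t : Op H) = t := congrArg Subtype.val ht
    rw [compression_apply, star_mul, hr, ht']
    simp only [MulMemClass.coe_mul, mul_assoc]
  refine ⟨compression M₀ ((t : Op H) * r), fun x => ?_, ?_, ?_⟩
  -- Cycling the trace puts `r²` against an element of `M₀`, where it may be replaced by `E(r²) =
  -- s²`.
  · rw [key, mul_assoc, tr_mul_comm, mul_assoc, ← tr_mul_condExp, hE, ← MulMemClass.coe_mul]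
    have : t * x * t * (s * s) = t * (x * s) := by
      calc _ = t * x * (t * s) * s := by simp only [mul_assoc]
        _ = _ := by rw [hts, mul_one, mul_assoc]
    rw [this, MulMemClass.coe_mul, tr_mul_comm, ← MulMemClass.coe_mul, mul_assoc, hst, mul_one]
  · have : t * (s * s) * t = 1 := by rw [← mul_assoc, hts, one_mul, hst]
    rw [key, hE, this]
    simp
  · rw [key, h]
    calc _ = (r * a) * ρ₁ * (a * r) := by simp only [mul_assoc]
      _ = _ := by rw [hra, har, one_mul, mul_one]

/-- Equality case of the monotonicity of `sandwich` under `E`, the reverse inequality being supplied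
by `T`. -/
theorem eq_of_sufficient (ha : 0 ≤ a) (hr : star r = r) (hs : 0 ≤ s) (ht : 0 ≤ t)
    (hra : r * a = 1) (har : a * r = 1) (hst : s * t = 1) (hts : t * s = 1)
    (hE : condExp M₀ (r * r) = s * s) {ρ₁ : Op H} (T : M₀ →CP Op H)
    (hT : ∀ x : M₀, tr (T x) = tr (x : Op H)) (hT₀ : T (condExp M₀ (r * r)) = r * r)
    (hT₁ : T (condExp M₀ ρ₁) = ρ₁) :
    ((t * condExp M₀ ρ₁ * t : M₀) : Op H) = a * ρ₁ * a := by
  have hsa := (IsSelfAdjoint.of_nonneg ha).star_eq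
  have hss := (IsSelfAdjoint.of_nonneg hs).star_eq
  have hsta := (IsSelfAdjoint.of_nonneg ht).star_eq
  have ht' : 0 ≤ (t : Op H) := ht
  have hst' : star (t : Op H) = t := congrArg Subtype.val hsta
  have hss' : star (s : Op H) = s := congrArg Subtype.val hss
  have hst1 : (s : Op H) * t = 1 := congrArg Subtype.val hst
  have hts1 : (t : Op H) * s = 1 := congrArg Subtype.val hts
  obtain ⟨E, hEx⟩ : ∃ E : Op H →ₗ[ℂ] Op H, ∀ x, E x = (condExp M₀ x : Op H) :=
    ⟨M₀.subtype.toAlgHom.toLinearMap ∘ₗ condExp M₀, fun _ => rfl⟩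
  obtain ⟨F, hFx⟩ : ∃ F : Op H →ₗ[ℂ] Op H, ∀ x, F x = T (condExp M₀ x) :=
    ⟨(T : M₀ →ₗ[ℂ] Op H) ∘ₗ condExp M₀, fun _ => rfl⟩
  have c1 (x : Op H) : (sandwich (t : Op H) (E x) (E x)).re ≤ (sandwich a x x).re :=
    sandwich_contraction E (fun x => by rw [hEx, hEx, condExp_star_apply, StarMemClass.coe_star])
      ha ht' har hra (fun x => by
        rw [hEx]; exact hsSq_condExp_le M₀ hr hss hsta har hsa hst hE x) x
  have c2 : (sandwich a ρ₁ ρ₁).re ≤ (sandwich (t : Op H) (E ρ₁) (E ρ₁)).re := by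
    have hEE : condExp M₀ ((s : Op H) * s) = s * s := condExp_coe M₀ (s * s)
    have hTs : T (s * s) = r * r := hE ▸ hT₀
    -- The interpolation needs a map on all of `B(H)`, so `T` is precomposed with `E`. The one-sided
    -- bound for `E` is used here at `s² = E(ρ₀)`, which `E` fixes.
    have h := sandwich_contraction F
      (fun x => by rw [hFx, hFx, condExp_star_apply, completelyPositive_map_star])
      ht' ha hts1 hst1
      (fun x => by
        rw [hFx]
        exact (hsSq_completelyPositive_le T hT hsa hss har hra hst hTs _).trans
          (hsSq_condExp_le M₀ hss' hss hsta hts1 hst' hst hEE x)) (E ρ₁)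
    rwa [hFx, hEx, condExp_coe, hT₁, ← hEx] at h
  -- `w` is the adjoint of `E` applied to `E ρ₁`, as `adj` records.
  set w := r * (t * E ρ₁ * t) * r with hw
  have hawa : a * w * a = t * E ρ₁ * t := by
    calc _ = (a * r) * (t * E ρ₁ * t) * (r * a) := by rw [hw]; simp only [mul_assoc]
      _ = _ := by rw [har, hra, one_mul, mul_one]
  have adj (x : Op H) : sandwich a x w = sandwich (t : Op H) (E x) (E ρ₁) := by
    have h := tr_mul_condExp M₀ (t * condExp M₀ ρ₁ * t) (star x)
    rw [condExp_star_apply, tr_mul_comm, tr_mul_comm _ (star x)] at h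
    simp only [MulMemClass.coe_mul, StarMemClass.coe_star, ← hEx] at h
    calc _ = tr (star x * (a * w * a)) := by simp only [sandwich, mul_assoc]
      _ = tr (star (E x) * ((t : Op H) * E ρ₁ * (t : Op H))) := by rw [hawa, h]
      _ = _ := by simp only [sandwich, mul_assoc]
  -- `h1` and `h2` bound the energy of `w` by that of `E ρ₁`; by `c2` so is the energy of `ρ₁`,
  -- while the cross term `⟨ρ₁, w⟩` equals it.
  have hzero : (sandwich a (ρ₁ - w) (ρ₁ - w)).re ≤ 0 := by
    have h1 := sandwich_self_nonneg ht' (E w - E ρ₁)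
    rw [sandwich_sub_self hst', ← adj w] at h1
    have h2 := c1 w
    rw [sandwich_sub_self hsa, adj ρ₁]
    linarith
  obtain ⟨b, hb, rfl⟩ := exists_selfAdjoint_mul_self ha
  rw [sandwich_self hb] at hzero
  have h0 := eq_zero_of_hsSq hzero
  have h1 : (b * b) * (ρ₁ - w) * (b * b) = 0 := by
    calc _ = b * (b * (ρ₁ - w) * b) * b := by simp only [mul_assoc]
      _ = 0 := by rw [h0]; simp
  rw [mul_sub, sub_mul, sub_eq_zero, hawa] at h1
  rw [h1]
  simp [hEx]

end Sufficiency

end QSuff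

theorem mainTheorem4 {H : Type*} [NormedAddCommGroup H] [InnerProductSpace ℂ H]
    [FiniteDimensional ℂ H] [CompleteSpace H] (M₀ : StarSubalgebra ℂ (QSuff.Op H))
    (ρ₀ ρ₁ : QSuff.Op H) (hρ₀ : QSuff.IsDensity ρ₀) (hρ₁ : QSuff.IsDensity ρ₁)
    (hu₀ : IsUnit ρ₀) (hu₁ : IsUnit ρ₁) :
    QSuff.IsSufficient M₀ ρ₀ ρ₁ ↔ QSuff.rnDeriv ρ₀ ρ₁ ∈ QSuff.fixedPoints M₀ ρ₀ := by
  open QSuff in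
  have hE := condExp_nonneg M₀ hρ₀.nonneg
  have huE := condExp_isUnit M₀ hρ₀.nonneg hu₀
  have hra := CFC.rpow_mul_rpow_neg (a := ρ₀) (1 / 2) (hu₀.isStrictlyPositive hρ₀.nonneg)
  have har := CFC.rpow_neg_mul_rpow (a := ρ₀) (1 / 2) (hu₀.isStrictlyPositive hρ₀.nonneg)
  have hst := CFC.rpow_mul_rpow_neg (a := condExp M₀ ρ₀) (1 / 2) (huE.isStrictlyPositive hE)
  have hts := CFC.rpow_neg_mul_rpow (a := condExp M₀ ρ₀) (1 / 2) (huE.isStrictlyPositive hE)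
  have hrr := sqrt_mul_sqrt hρ₀.nonneg hu₀
  have hss := sqrt_mul_sqrt hE huE
  have hr : 0 ≤ ρ₀ ^ (1 / 2 : ℝ) := CFC.rpow_nonneg
  have ha : 0 ≤ ρ₀ ^ (-(1 / 2) : ℝ) := CFC.rpow_nonneg
  have hs : 0 ≤ condExp M₀ ρ₀ ^ (1 / 2 : ℝ) := CFC.rpow_nonneg
  have ht : 0 ≤ condExp M₀ ρ₀ ^ (-(1 / 2) : ℝ) := CFC.rpow_nonneg
  have hr' := (IsSelfAdjoint.of_nonneg hr).star_eq
  have ht' := (IsSelfAdjoint.of_nonneg ht).star_eq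
  have hfix : rnDeriv ρ₀ ρ₁ ∈ fixedPoints M₀ ρ₀ ↔
      ((condExp M₀ ρ₀ ^ (-(1 / 2) : ℝ) * condExp M₀ ρ₁ * condExp M₀ ρ₀ ^ (-(1 / 2) : ℝ) : M₀) :
        Op H) = ρ₀ ^ (-(1 / 2) : ℝ) * ρ₁ * ρ₀ ^ (-(1 / 2) : ℝ) := by
    have e : ρ₀ ^ (1 / 2 : ℝ) * rnDeriv ρ₀ ρ₁ * ρ₀ ^ (1 / 2 : ℝ) = ρ₁ := by
      rw [rnDeriv]
      calc _ = (ρ₀ ^ (1 / 2 : ℝ) * ρ₀ ^ (-(1 / 2) : ℝ)) * ρ₁ *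
            (ρ₀ ^ (-(1 / 2) : ℝ) * ρ₀ ^ (1 / 2 : ℝ)) := by simp only [mul_assoc]
        _ = _ := by rw [hra, har, one_mul, mul_one]
    rw [fixedPoints, Set.mem_ofPred_eq, genCondExp_apply, e]
    rfl
  rw [hfix]
  generalize condExp M₀ ρ₀ ^ (1 / 2 : ℝ) = s at *
  generalize condExp M₀ ρ₀ ^ (-(1 / 2) : ℝ) = t at *
  generalize ρ₀ ^ (1 / 2 : ℝ) = r at *
  generalize ρ₀ ^ (-(1 / 2) : ℝ) = a at *
  subst hrr
  constructor
  · rintro ⟨T, hT, hT₀, hT₁⟩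
    exact eq_of_sufficient ha hr' hs ht hra har hst hts hss.symm T hT hT₀ hT₁
  · exact exists_recovery hr' ht' hra har hst hts hss.symm
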